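/- Theorem 2.6. Let $R$ be a commutative noetherian ring, let $R\text{-}\mathrm{Mod}$ be the category of $R$-modules, and let $\gamma : R\text{-}\mathrm{Mod} \to R\text{-}\mathrm{Mod}$ be a left exact preradical functor, that is, a left exact subfunctor of the identity functor. Then the following conditions are equivalent. (1) $\gamma$ is a radical functor: $\gamma(M/\gamma(M)) = 0$ for every $R$-module $M$. (2) $\gamma$ preserves injectivity: $\gamma(I)$ is an injective $R$-module for every injective $R$-module $I$. (3) There is a specialization-closed subset $W \subseteq \mathrm{Spec}(R)$ (that is, $\mathfrak p \in W$ and $\mathfrak p \subseteq \mathfrak q \in \mathrm{Spec}(R)$ imply $\mathfrak q \in W$) such that $\gamma = \varGamma_W$ as subfunctors of the identity functor, where $\varGamma_W(M) = \{x \in M \mid \mathrm{Supp}(Rx) \subseteq W\}$ for every $R$-module $M$. (4) The right derived functor $\mathbf{R}\gamma : \mathcal D^+(R\text{-}\mathrm{Mod}) \to \mathcal D^+(R\text{-}\mathrm{Mod})$ on the derived category of left-bounded complexes is an abstract local cohomology functor. Here a functor $\delta : \mathcal T \to \mathcal T$ on $\mathcal T = \mathcal D^+(R\text{-}\mathrm{Mod})$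 is called an abstract local cohomology functor if it is a triangle functor (it is additive, commutes with the shift up to natural isomorphism, and sends distinguished triangles to distinguished triangles) and the following two conditions hold, where $\mathrm{Im}(\delta)$ is the full subcategory of all objects isomorphic to some $\delta(X)$, and $\mathrm{Ker}(\delta)$ is the full subcategory of all $X$ with $\delta(X) \cong 0$: (a) the embedding $i : \mathrm{Im}(\delta) \to \mathcal T$ has a right adjoint $\rho : \mathcal T \to \mathrm{Im}(\delta)$ with $\delta \cong i \circ \rho$; (b) each indecomposable injective $R$-module, regarded as a complex concentrated in degree $0$, belongs to $\mathrm{Im}(\delta)$ or to $\mathrm{Ker}(\delta)$. -/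

import Mathlib

open CategoryTheory CategoryTheory.Limits

universe w u

namespace LocalCohomologyFunctors

section Preradicals

variable {R : Type u} [CommRing R]

/-- A subfunctor of the identity functor is automatically an additive functor. -/
instance additive_r (γ : Abelian.Preradical (ModuleCat.{u} R)) : γ.r.Additive where
  map_add {X Y f g} := by
    rw [← cancel_mono (γ.ι.app Y)]
    have h (k : X ⟶ Y) : γ.r.map k ≫ γ.ι.app Y = γ.ι.app X ≫ k := γ.ι.naturality k
    rw [Preadditive.add_comp, h, h, h, Preadditive.comp_add]

/-- The value `γ(M)`, as a submodule of `M`. -/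
noncomputable def valueSubmodule (γ : Abelian.Preradical (ModuleCat.{u} R))
    (M : ModuleCat.{u} R) : Submodule R M :=
  LinearMap.range (γ.ι.app M).hom

/-- A preradical functor `γ` is radical if `γ(M / γ(M)) = 0` for every `R`-module `M`. -/
def IsRadicalFunctor (γ : Abelian.Preradical (ModuleCat.{u} R)) : Prop :=
  ∀ M : ModuleCat.{u} R, IsZero (γ.r.obj (ModuleCat.of R (M ⧸ valueSubmodule γ M)))

theorem support_span_singleton_subset_iff {M : Type*} [AddCommGroup M] [Module R M]
    (W : Set (PrimeSpectrum R)) (x : M) :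
    Module.support R (Submodule.span R {x}) ⊆ W ↔
      ∀ p : PrimeSpectrum R, (∀ r : R, r • x = 0 → r ∈ p.asIdeal) → p ∈ W := by
  rw [Module.support_eq_zeroLocus]
  refine forall_congr' fun p => ?_
  have h : p ∈ PrimeSpectrum.zeroLocus (Module.annihilator R (Submodule.span R {x}) : Set R) ↔
      ∀ r : R, r • x = 0 → r ∈ p.asIdeal := by
    rw [PrimeSpectrum.mem_zeroLocus]
    refine forall_congr' fun r => ?_
    change r ∈ (Submodule.span R {x}).annihilator → _ ↔ _
    rw [Submodule.mem_annihilator_span_singleton]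
    rfl
  rw [h]

/-- `Γ_W(M) = {x ∈ M | Supp(Rx) ⊆ W}`, as a submodule of `M`. -/
def sectionSubmodule (W : Set (PrimeSpectrum R)) (M : Type*) [AddCommGroup M] [Module R M] :
    Submodule R M where
  carrier := {x | Module.support R (Submodule.span R {x}) ⊆ W}
  zero_mem' := by
    rw [Set.mem_ofPred_eq, support_span_singleton_subset_iff]
    intro p hp
    exact absurd (hp 1 (by simp)) p.1.one_notMem
  add_mem' {x y} hx hy := by
    rw [Set.mem_ofPred_eq, support_span_singleton_subset_iff] at *
    intro p hp
    by_cases h : ∀ r : R, r • x = 0 → r ∈ p.asIdeal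
    · exact hx p h
    · push Not at h
      obtain ⟨r, hr, hrp⟩ := h
      refine hy p fun s hs => ?_
      have := hp (r * s) (by rw [smul_add, mul_comm, mul_smul, hr, mul_comm, mul_smul, hs]; simp)
      exact (p.2.mem_or_mem this).resolve_left hrp
  smul_mem' a x hx := by
    rw [Set.mem_ofPred_eq, support_span_singleton_subset_iff] at *
    intro p hp
    exact hx p fun r hr => hp r (by rw [smul_comm, hr, smul_zero])

theorem sectionSubmodule_le_comap (W : Set (PrimeSpectrum R)) {M N : Type*} [AddCommGroup M]
    [Module R M] [AddCommGroup N] [Module R N] (f : M →ₗ[R] N) :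
    sectionSubmodule W M ≤ (sectionSubmodule W N).comap f := by
  intro x hx
  change Module.support R (Submodule.span R {f x}) ⊆ W
  replace hx : Module.support R (Submodule.span R {x}) ⊆ W := hx
  rw [support_span_singleton_subset_iff] at *
  intro p hp
  exact hx p fun r hr => hp r (by rw [← map_smul, hr, map_zero])

/-- The section functor `Γ_W : R-Mod ⥤ R-Mod`; it acts on morphisms by restriction. -/
def sectionFunctor (W : Set (PrimeSpectrum R)) : ModuleCat.{u} R ⥤ ModuleCat.{u} R where
  obj M := ModuleCat.of R (sectionSubmodule W M)
  map f := ModuleCat.ofHom (f.hom.restrict (sectionSubmodule_le_comap W f.hom))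

/-- The inclusion `Γ_W(M) ⊆ M`. -/
def sectionInclusion (W : Set (PrimeSpectrum R)) :
    sectionFunctor W ⟶ 𝟭 (ModuleCat.{u} R) where
  app M := ModuleCat.ofHom (sectionSubmodule W M).subtype

instance (W : Set (PrimeSpectrum R)) : Mono (sectionInclusion W) := by
  rw [NatTrans.mono_iff_mono_app]
  intro M
  exact (ModuleCat.mono_iff_injective _).2 (sectionSubmodule W M).injective_subtype

/-- `Γ_W` as a subfunctor of the identity functor. -/
def sectionPreradical (W : Set (PrimeSpectrum R)) : Abelian.Preradical (ModuleCat.{u} R) :=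
  MonoOver.mk (sectionInclusion W)

/-- `γ = Γ_W` for some specialization-closed `W ⊆ Spec R`. The isomorphism is one over the identity
functor, that is, `γ` and `Γ_W` are equal as subfunctors of the identity functor. -/
def IsSectionFunctor (γ : Abelian.Preradical (ModuleCat.{u} R)) : Prop :=
  ∃ W : Set (PrimeSpectrum R), StableUnderSpecialization W ∧ Nonempty (γ ≅ sectionPreradical W)

end Preradicals

section Derived

variable {R : Type u} [CommRing R] [HasDerivedCategory.{w} (ModuleCat.{u} R)]

/-- Abstract local cohomology functors on `D⁺(R-Mod)`. -/
structure IsAbstractLocalCohomology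
    (δ : DerivedCategory.Plus (ModuleCat.{u} R) ⥤ DerivedCategory.Plus (ModuleCat.{u} R)) :
    Prop where
  /-- `δ` is a triangle functor. -/
  triangle : ∃ _ : δ.CommShift ℤ, δ.IsTriangulated
  /-- The embedding `i : Im δ ⥤ D⁺(R-Mod)` has a right adjoint `ρ`, and `δ ≅ i ∘ ρ`. -/
  adjoint : ∃ ρ : DerivedCategory.Plus (ModuleCat.{u} R) ⥤ δ.essImage.FullSubcategory,
    Nonempty (δ.essImage.ι ⊣ ρ) ∧ Nonempty (δ ≅ ρ ⋙ δ.essImage.ι)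
  /-- Every indecomposable injective module, placed in degree `0`, is in `Im δ` or in `Ker δ`. -/
  divides : ∀ E : ModuleCat.{u} R, Injective E → Indecomposable E →
    δ.essImage ((DerivedCategory.Plus.singleFunctor (ModuleCat.{u} R) 0).obj E) ∨
      δ.kernel ((DerivedCategory.Plus.singleFunctor (ModuleCat.{u} R) 0).obj E)

end Derived

end LocalCohomologyFunctors

/-! A left exact preradical is hereditary: `γ(N) = N ∩ γ(M)` for `N ≤ M`. Hence `x ∈ γ(M)` exactly
when `R / ann(x)` is torsion (`mem_torsion_iff`), so `γ` is governed by its torsion ideals, which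
are closed upwards and under finite intersections. It is `Γ_W`, with `W` the torsion primes, once
every ideal whose prime overideals are all torsion is itself torsion
(`isSectionFunctor_of_forall_isTorsionIdeal`).

If `γ` is radical, an associated prime of a nonzero `(R/I) / γ(R/I)` violates torsion-freeness, so
this criterion holds. If `γ = Γ_W`, then `Γ_W(I)` has no proper essential extension in an injective
`I`, hence is a direct summand. If `γ(I)` is injective, a retraction `I ⟶ γ(I)` yields radicality.

For the derived statement, `D⁺` is equivalent to `K⁺` of injectives. When `γ` preserves injectives,
`Rγ` and its augmentation to the identity are computed termwise there, and idempotence of `γ` makes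
`Rγ` a coreflection. Conversely, an abstract local cohomology functor `Rγ` forces `γ(E) = E` or
`γ(E) = 0` for each indecomposable injective `E`. Noetherian induction reduces the criterion to
irreducible ideals `I`, and for these `R/I` embeds in a torsion `E`. -/

namespace LocalCohomologyFunctors

/-! ### Coreflections onto essential images -/

section Coreflection

variable {T : Type*} [Category* T]

/-- An endofunctor `δ` with an augmentation `ε : δ ⟶ 𝟭` such that `ε_{δ X}` and `δ(ε_X)` are
isomorphisms is the coreflection onto its essential image. -/
theorem exists_rightAdjoint_essImage_ι (δ : T ⥤ T) (ε : δ ⟶ 𝟭 T)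
    (h₁ : ∀ X, IsIso (ε.app (δ.obj X))) (h₂ : ∀ X, IsIso (δ.map (ε.app X))) :
    ∃ ρ : T ⥤ δ.essImage.FullSubcategory,
      Nonempty (δ.essImage.ι ⊣ ρ) ∧ Nonempty (δ ≅ ρ ⋙ δ.essImage.ι) := by
  have h₃ (Y : δ.essImage.FullSubcategory) : IsIso (ε.app Y.obj) := by
    obtain ⟨X, ⟨e⟩⟩ := Y.property
    exact (NatTrans.isIso_app_iff_of_iso ε e).1 (h₁ X)
  have nat {X Y : T} (f : X ⟶ Y) : δ.map f ≫ ε.app Y = ε.app X ≫ f := ε.naturality f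
  -- Composition with `ε_X` is injective on maps from the image: `δ(ε_X)` is cancellable, and `ε_Y`
  -- recovers `f` from `δ(f)`. With `fac` this makes it the adjunction bijection.
  have inj (Y : δ.essImage.FullSubcategory) {X : T} (f g : Y.obj ⟶ δ.obj X)
      (h : f ≫ ε.app X = g ≫ ε.app X) : f = g := by
    have := h₂ X
    have h' : δ.map f = δ.map g := by
      rw [← cancel_mono (δ.map (ε.app X)), ← Functor.map_comp, ← Functor.map_comp, h]
    rw [← cancel_epi (ε.app Y.obj), ← nat, ← nat, h']
  have fac (Y : δ.essImage.FullSubcategory) {X : T} (f : Y.obj ⟶ X) :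
      (inv (ε.app Y.obj) ≫ δ.map f) ≫ ε.app X = f := by simp
  let ρ : T ⥤ δ.essImage.FullSubcategory := δ.essImage.lift δ fun X => δ.obj_mem_essImage X
  refine ⟨ρ, ⟨Adjunction.mkOfHomEquiv
    { homEquiv Y X :=
      { toFun f := ObjectProperty.homMk (inv (ε.app Y.obj) ≫ δ.map f)
        invFun g := g.hom ≫ ε.app X
        left_inv f := fac Y f
        right_inv g := by
          ext
          exact inj Y _ _ (fac Y _) }
      homEquiv_naturality_left_symm f g := Category.assoc _ _ _
      homEquiv_naturality_right {Y X X'} f g := by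
        ext
        change inv (ε.app Y.obj) ≫ δ.map (f ≫ g) = (inv (ε.app Y.obj) ≫ δ.map f) ≫ δ.map g
        simp }⟩, ⟨Iso.refl _⟩⟩

/-- If the embedding of the essential image of `δ` has a right adjoint `ρ` such that `δ ≅ i ∘ ρ`,
then `δ X ≅ X` for all `X` in the essential image. -/
theorem nonempty_iso_obj_of_essImage {δ : T ⥤ T} {ρ : T ⥤ δ.essImage.FullSubcategory}
    (adj : δ.essImage.ι ⊣ ρ) (e : δ ≅ ρ ⋙ δ.essImage.ι) {X : T} (hX : δ.essImage X) :
    Nonempty (δ.obj X ≅ X) :=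
  ⟨e.app X ≪≫ δ.essImage.ι.mapIso (asIso (adj.unit.app ⟨X, hX⟩)).symm⟩

end Coreflection

/-! ### Triangulated structures transported along equivalences -/

section Triangulated

open Pretriangulated

variable {K T T' : Type*} [Category* K] [Category* T] [Category* T']
  [HasZeroObject K] [HasZeroObject T] [HasZeroObject T']
  [HasShift K ℤ] [HasShift T ℤ] [HasShift T' ℤ]
  [Preadditive K] [Preadditive T] [Preadditive T']
  [∀ n : ℤ, (shiftFunctor K n).Additive] [∀ n : ℤ, (shiftFunctor T n).Additive]
  [∀ n : ℤ, (shiftFunctor T' n).Additive]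
  [Pretriangulated K] [Pretriangulated T] [Pretriangulated T']

/-- A functor which becomes triangulated after composition with a triangulated equivalence is
triangulated. -/
theorem exists_commShift_isTriangulated_of_equivalence (E : K ≌ T) [E.functor.CommShift ℤ]
    [E.functor.IsTriangulated] {H : K ⥤ T'} [H.CommShift ℤ] [H.IsTriangulated]
    {G : T ⥤ T'} (e : E.functor ⋙ G ≅ H) :
    ∃ _ : G.CommShift ℤ, G.IsTriangulated := by
  let := E.commShiftInverse ℤ
  have := E.commShift_of_functor ℤ
  have := CategoryTheory.Equivalence.IsTriangulated.mk' E inferInstance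
  let e' : E.inverse ⋙ H ≅ G := Functor.isoWhiskerLeft _ e.symm ≪≫
    (Functor.associator _ _ _).symm ≪≫
    Functor.isoWhiskerRight E.counitIso _ ≪≫ Functor.leftUnitor _
  let := Functor.CommShift.ofIso e' ℤ
  have := Functor.CommShift.ofIso_compatibility e' ℤ
  exact ⟨inferInstance, Functor.isTriangulated_of_iso e'⟩

end Triangulated

/-! ### Right derived functors via complexes of injectives -/

section Derived

variable {C D : Type*} [Category* C] [Category* D] [Abelian C] [Abelian D]
  [HasDerivedCategory C] [HasDerivedCategory D] [EnoughInjectives C]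

variable (C) in
/-- The functor `K⁺(Inj C) ⥤ D⁺(C)`. -/
noncomputable abbrev injectiveQh :
    HomotopyCategory.Plus (InjectiveObject C) ⥤ DerivedCategory.Plus C :=
  (InjectiveObject.ι C).mapHomotopyCategoryPlus ⋙ DerivedCategory.Plus.Qh

omit [HasDerivedCategory C] [EnoughInjectives C] in
theorem isKInjective_of_plus (K : HomotopyCategory.Plus C)
    (hK : ∀ n : ℤ, Injective (K.obj.as.X n)) : CochainComplex.IsKInjective K.obj.as := by
  obtain ⟨n, _⟩ := (HomotopyCategory.plus_quotient_obj_iff K.obj.as).mp K.property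
  exact CochainComplex.isKInjective_of_injective K.obj.as n

/-- Maps into a K-injective complex agree in `K⁺` and `D⁺`, which gives full faithfulness. Essential
surjectivity, left to instance search, is the existence of injective resolutions. -/
instance : (injectiveQh C).IsEquivalence where
  faithful := ⟨fun {X Y} f g h => by
    have := isKInjective_of_plus ((InjectiveObject.ι C).mapHomotopyCategoryPlus.obj Y) inferInstance
    exact (InjectiveObject.ι C).mapHomotopyCategoryPlus.map_injective
      ((DerivedCategory.Plus.Qh_map_bijective_of_isKInjective _ _ this).injective h)⟩
  full := ⟨fun {X Y} f => by
    have := isKInjective_of_plus ((InjectiveObject.ι C).mapHomotopyCategoryPlus.obj Y) inferInstance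
    obtain ⟨g, rfl⟩ := (DerivedCategory.Plus.Qh_map_bijective_of_isKInjective _ _ this).surjective f
    obtain ⟨g, rfl⟩ := (InjectiveObject.ι C).mapHomotopyCategoryPlus.map_surjective g
    exact ⟨g, rfl⟩⟩

section

variable (F : C ⥤ D) [F.Additive]

/-- The right derived functor of `F` is computed by applying `F` to complexes of injectives. -/
noncomputable def injectiveQhCompRightDerivedIso :
    injectiveQh C ⋙ F.rightDerivedFunctorPlus ≅
      (InjectiveObject.ι C).mapHomotopyCategoryPlus ⋙ F.mapHomotopyCategoryPlus ⋙
        DerivedCategory.Plus.Qh :=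
  (NatIso.ofComponents (fun X => asIso (F.rightDerivedFunctorPlusUnit.app
    ((InjectiveObject.ι C).mapHomotopyCategoryPlus.obj X)))
    (fun _ => F.rightDerivedFunctorPlusUnit.naturality _)).symm

theorem exists_commShift_isTriangulated :
    ∃ _ : F.rightDerivedFunctorPlus.CommShift ℤ, F.rightDerivedFunctorPlus.IsTriangulated := by
  let a : (injectiveQh C).CommShift ℤ := inferInstance
  have b : (injectiveQh C).IsTriangulated := inferInstance
  exact @exists_commShift_isTriangulated_of_equivalence _ _ _ _ _ _ _ _ _ _ _ _ _ _ _ _ _ _ _ _ _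
    (injectiveQh C).asEquivalence a b _ _ _ _ (injectiveQhCompRightDerivedIso F)

end

section Augmentation

variable (F : C ⥤ C) [F.Additive] (ι : F ⟶ 𝟭 C)

/-- The morphism `F(K) ⟶ K` of complexes induced by an augmentation of `F`. -/
def mapHomologicalComplexAug (K : CochainComplex C ℤ) :
    (F.mapHomologicalComplex (.up ℤ)).obj K ⟶ K where
  f n := ι.app (K.X n)
  comm' _ _ _ := (ι.naturality _).symm

/-- The transformation of functors on `K⁺(C)` induced by an augmentation. -/
noncomputable def mapHomotopyCategoryPlusAug : F.mapHomotopyCategoryPlus ⟶ 𝟭 _ where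
  app K := ObjectProperty.homMk ((HomotopyCategory.quotient C (.up ℤ)).map
    (mapHomologicalComplexAug F ι K.obj.as))
  naturality K L f := by
    obtain ⟨f, rfl⟩ := ObjectProperty.homMk_surjective f
    obtain ⟨f, rfl⟩ := (HomotopyCategory.quotient C (.up ℤ)).map_surjective f
    ext
    refine ((HomotopyCategory.quotient C (.up ℤ)).map_comp _ _).symm.trans
      (Eq.trans ?_ ((HomotopyCategory.quotient C (.up ℤ)).map_comp _ _))
    congr 1
    ext n
    exact ι.naturality _

omit [HasDerivedCategory C] [EnoughInjectives C] in
/-- A morphism in `K⁺(C)` is an isomorphism if it is represented by an isomorphism in each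
degree. -/
theorem isIso_homMk_quotient_map {K L : HomotopyCategory.Plus C} (f : K.obj.as ⟶ L.obj.as)
    (hf : ∀ n, IsIso (f.f n)) :
    IsIso (ObjectProperty.homMk ((HomotopyCategory.quotient C (.up ℤ)).map f) : K ⟶ L) := by
  have := HomologicalComplex.Hom.isIso_of_components f
  have h : IsIso ((HomotopyCategory.Plus.ι C).map
      (ObjectProperty.homMk ((HomotopyCategory.quotient C (.up ℤ)).map f) : K ⟶ L)) :=
    inferInstanceAs (IsIso ((HomotopyCategory.quotient C (.up ℤ)).map f))
  exact isIso_of_fully_faithful (HomotopyCategory.Plus.ι C) _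

/-- The augmentation of the right derived functor. -/
noncomputable def rightDerivedAug : F.rightDerivedFunctorPlus ⟶ 𝟭 _ :=
  F.rightDerivedFunctorPlus.rightDerivedDesc F.rightDerivedFunctorPlusUnit
    (HomotopyCategory.Plus.quasiIso C) (𝟭 _)
    (Functor.whiskerRight (mapHomotopyCategoryPlusAug F ι) DerivedCategory.Plus.Qh)

theorem unit_comp_rightDerivedAug (K : HomotopyCategory.Plus C) :
    F.rightDerivedFunctorPlusUnit.app K ≫
      (rightDerivedAug F ι).app (DerivedCategory.Plus.Qh.obj K) =
    DerivedCategory.Plus.Qh.map ((mapHomotopyCategoryPlusAug F ι).app K) :=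
  Functor.rightDerived_fac_app _ _ _ _ _ _

/-- The unit `F(K) ⟶ RF(K)` is invertible on complexes of injectives, so the derived augmentation is
the termwise one up to isomorphism. -/
theorem isIso_rightDerivedAug_app (K : HomotopyCategory.Plus C)
    (hK : ∀ n : ℤ, Injective (K.obj.as.X n)) (hι : ∀ n, IsIso (ι.app (K.obj.as.X n))) :
    IsIso ((rightDerivedAug F ι).app (DerivedCategory.Plus.Qh.obj K)) := by
  have : IsIso ((mapHomotopyCategoryPlusAug F ι).app K) := isIso_homMk_quotient_map _ hι
  have : IsIso (F.rightDerivedFunctorPlusUnit.app K ≫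
      (rightDerivedAug F ι).app (DerivedCategory.Plus.Qh.obj K)) := by
    rw [unit_comp_rightDerivedAug]
    infer_instance
  exact IsIso.of_isIso_comp_left (F.rightDerivedFunctorPlusUnit.app K) _

/-- Preservation of injectives makes the unit invertible at `F(K)` as well as at `K`, so `RF` of the
termwise augmentation is `F` applied termwise. -/
theorem isIso_map_rightDerivedAug_app [F.PreservesInjectiveObjects] (K : HomotopyCategory.Plus C)
    (hK : ∀ n : ℤ, Injective (K.obj.as.X n)) (hι : ∀ X, IsIso (F.map (ι.app X))) :
    IsIso (F.rightDerivedFunctorPlus.map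
      ((rightDerivedAug F ι).app (DerivedCategory.Plus.Qh.obj K))) := by
  let a := (mapHomotopyCategoryPlusAug F ι).app K
  have hFK (n : ℤ) : Injective ((F.mapHomotopyCategoryPlus.obj K).obj.as.X n) :=
    inferInstanceAs (Injective (F.obj (K.obj.as.X n)))
  have h₁ : IsIso (F.mapHomotopyCategoryPlus.map a) :=
    isIso_homMk_quotient_map (K := F.mapHomotopyCategoryPlus.obj (F.mapHomotopyCategoryPlus.obj K))
      (L := F.mapHomotopyCategoryPlus.obj K)
      ((F.mapHomologicalComplex _).map (mapHomologicalComplexAug F ι K.obj.as)) fun n => hι _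
  have h₂ : IsIso (F.rightDerivedFunctorPlus.map (DerivedCategory.Plus.Qh.map a)) := by
    have h : F.rightDerivedFunctorPlusUnit.app (F.mapHomotopyCategoryPlus.obj K) ≫
        F.rightDerivedFunctorPlus.map (DerivedCategory.Plus.Qh.map a) =
        DerivedCategory.Plus.Qh.map (F.mapHomotopyCategoryPlus.map a) ≫
          F.rightDerivedFunctorPlusUnit.app K :=
      (F.rightDerivedFunctorPlusUnit.naturality a).symm
    have : IsIso (F.rightDerivedFunctorPlusUnit.app (F.mapHomotopyCategoryPlus.obj K) ≫
        F.rightDerivedFunctorPlus.map (DerivedCategory.Plus.Qh.map a)) := by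
      rw [h]
      infer_instance
    exact IsIso.of_isIso_comp_left
      (F.rightDerivedFunctorPlusUnit.app (F.mapHomotopyCategoryPlus.obj K)) _
  rw [← unit_comp_rightDerivedAug, Functor.map_comp] at h₂
  exact IsIso.of_isIso_comp_left (F.rightDerivedFunctorPlus.map
    (F.rightDerivedFunctorPlusUnit.app K)) _

/-- Each object of `D⁺` is represented by a complex of injectives `K`, and its image under `RF` by
`F(K)`, again a complex of injectives. Both conditions for a coreflection thus become termwise. -/
theorem rightDerivedFunctorPlus_exists_rightAdjoint [F.PreservesInjectiveObjects]
    (h₁ : ∀ X, IsIso (ι.app (F.obj X))) (h₂ : ∀ X, IsIso (F.map (ι.app X))) :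
    ∃ ρ : DerivedCategory.Plus C ⥤ F.rightDerivedFunctorPlus.essImage.FullSubcategory,
      Nonempty (F.rightDerivedFunctorPlus.essImage.ι ⊣ ρ) ∧
        Nonempty (F.rightDerivedFunctorPlus ≅ ρ ⋙ F.rightDerivedFunctorPlus.essImage.ι) := by
  refine exists_rightAdjoint_essImage_ι _ (rightDerivedAug F ι) (fun X => ?_) fun X => ?_
  · let K := (InjectiveObject.ι C).mapHomotopyCategoryPlus.obj ((injectiveQh C).objPreimage X)
    let e : DerivedCategory.Plus.Qh.obj (F.mapHomotopyCategoryPlus.obj K) ≅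
        F.rightDerivedFunctorPlus.obj X := asIso (F.rightDerivedFunctorPlusUnit.app K) ≪≫
      F.rightDerivedFunctorPlus.mapIso ((injectiveQh C).objObjPreimageIso X)
    refine (NatTrans.isIso_app_iff_of_iso (rightDerivedAug F ι) e).1 ?_
    exact isIso_rightDerivedAug_app F ι _
      (fun n => inferInstanceAs (Injective (F.obj (K.obj.as.X n)))) fun n => h₁ _
  · let K := (InjectiveObject.ι C).mapHomotopyCategoryPlus.obj ((injectiveQh C).objPreimage X)
    exact (NatTrans.isIso_app_iff_of_iso
      (Functor.whiskerRight (rightDerivedAug F ι) F.rightDerivedFunctorPlus)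
      ((injectiveQh C).objObjPreimageIso X)).1
      (isIso_map_rightDerivedAug_app F ι K inferInstance h₂)

end Augmentation

section Single

variable (F : C ⥤ D) [F.Additive]

/-- The right derived functor of `F` at an injective object `E` in degree `0` is `F(E)` in degree
`0`. -/
theorem nonempty_rightDerivedFunctorPlus_obj_single_iso (E : C) [Injective E] :
    Nonempty (F.rightDerivedFunctorPlus.obj ((DerivedCategory.Plus.singleFunctor C 0).obj E) ≅
      (DerivedCategory.Plus.singleFunctor D 0).obj (F.obj E)) := by
  let K : HomotopyCategory.Plus C := (HomotopyCategory.Plus.singleFunctor C 0).obj E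
  have hK (n : ℤ) : Injective (K.obj.as.X n) := by
    change Injective (((CochainComplex.singleFunctor C 0).obj E).X n)
    by_cases hn : n = 0
    · subst hn
      exact Injective.of_iso (HomologicalComplex.singleObjXSelf (.up ℤ) 0 E).symm inferInstance
    · exact (HomologicalComplex.isZero_single_obj_X (.up ℤ) 0 E n hn).injective
  let e : F.mapHomotopyCategoryPlus.obj K ≅
      (HomotopyCategory.Plus.singleFunctor D 0).obj (F.obj E) :=
    (HomotopyCategory.Plus.fullyFaithfulι D).preimageIso
      ((HomotopyCategory.quotient D (.up ℤ)).mapIso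
        ((HomologicalComplex.singleMapHomologicalComplex F (.up ℤ) 0).app E))
  exact ⟨(asIso (F.rightDerivedFunctorPlusUnit.app K)).symm ≪≫
    DerivedCategory.Plus.Qh.mapIso e⟩

omit [EnoughInjectives C] in
theorem nonempty_iso_of_singleFunctor_obj_iso {X Y : C}
    (e : (DerivedCategory.Plus.singleFunctor C 0).obj X ≅
      (DerivedCategory.Plus.singleFunctor C 0).obj Y) : Nonempty (X ≅ Y) :=
  ⟨(DerivedCategory.singleFunctor C 0).preimageIso (DerivedCategory.Plus.ι.mapIso e)⟩

omit [EnoughInjectives C] in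
theorem isZero_singleFunctor_obj_iff (X : C) :
    IsZero ((DerivedCategory.Plus.singleFunctor C 0).obj X) ↔ IsZero X := by
  refine ⟨fun h => ?_, fun h => Functor.map_isZero _ h⟩
  obtain ⟨e⟩ := nonempty_iso_of_singleFunctor_obj_iso
    (h.iso (Functor.map_isZero (DerivedCategory.Plus.singleFunctor C 0) (isZero_zero C)))
  exact (isZero_zero C).of_iso e

theorem kernel_rightDerivedFunctorPlus_single_iff (E : C) [Injective E] :
    F.rightDerivedFunctorPlus.kernel ((DerivedCategory.Plus.singleFunctor C 0).obj E) ↔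
      IsZero (F.obj E) := by
  obtain ⟨e⟩ := nonempty_rightDerivedFunctorPlus_obj_single_iso F E
  exact e.isZero_iff.trans (isZero_singleFunctor_obj_iff _)

end Single

end Derived

/-! ### Essential submodules and indecomposable injectives -/

section InjectiveModules

theorem exists_maximal_disjoint {R M : Type*} [Ring R] [AddCommGroup M] [Module R M]
    {A B : Submodule R M} (h : Disjoint A B) :
    ∃ K, A ≤ K ∧ Disjoint K B ∧ ∀ K', K ≤ K' → Disjoint K' B → K' ≤ K := by
  have hz : ∀ c ⊆ {K : Submodule R M | Disjoint K B}, IsChain (· ≤ ·) c → ∀ y ∈ c,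
      ∃ ub ∈ {K : Submodule R M | Disjoint K B}, ∀ z ∈ c, z ≤ ub := fun c hc hch y _ =>
    ⟨sSup c, (DirectedOn.disjoint_sSup_left hch.directedOn).2 fun K hK => hc hK,
      fun z hz => le_sSup hz⟩
  obtain ⟨K, hAK, hK⟩ := zorn_le_nonempty₀ _ hz A h
  exact ⟨K, hAK, hK.1, fun K' h₁ h₂ => hK.2 h₂ h₁⟩

variable {R : Type u} [CommRing R]

/-- Every submodule of an injective module is essential in some direct summand. -/
theorem exists_essential_isCompl {M : Type u} [AddCommGroup M] [Module R M] [Module.Injective R M]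
    (N : Submodule R M) :
    ∃ E K : Submodule R M, N ≤ E ∧ IsCompl E K ∧ ∀ X ≤ E, Disjoint X N → X = ⊥ := by
  -- `K` is maximal disjoint from `N`, and `E ⊇ N` is maximal disjoint from `K`.
  obtain ⟨K, -, hKN, hK⟩ := exists_maximal_disjoint (disjoint_bot_left : Disjoint ⊥ N)
  obtain ⟨E, hNE, hEK, hE⟩ := exists_maximal_disjoint hKN.symm
  refine ⟨E, K, hNE, ⟨hEK, ?_⟩, fun X hXE hXN => ?_⟩
  · have hj : Function.Injective (K.mkQ ∘ₗ E.subtype) := by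
      refine (injective_iff_map_eq_zero _).2 fun e he => Subtype.ext ?_
      exact Submodule.disjoint_def.1 hEK e e.2 (by simpa using he)
    -- `E` embeds in `M / K`; extending its inclusion into `M` gives `φ`. The two maximality
    -- properties force `M ⟶ M / K ⟶ M` to be a projection onto `E` along `K`.
    obtain ⟨φ, hφ⟩ := Module.Injective.out (K.mkQ ∘ₗ E.subtype) hj E.subtype
    have hφE (e : M) (he : e ∈ E) : φ (K.mkQ e) = e := hφ ⟨e, he⟩
    have hY : K.comap (φ ∘ₗ K.mkQ) ≤ K := by
      refine hK _ (fun k hk => ?_) (Submodule.disjoint_def.2 fun y hy hyN => ?_)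
      · have : K.mkQ k = 0 := by simpa using hk
        simp [this]
      · have hy' : φ (K.mkQ y) ∈ K := hy
        rw [hφE y (hNE hyN)] at hy'
        exact Submodule.disjoint_def.1 hEK y (hNE hyN) hy'
    have hr : LinearMap.range φ ≤ E := by
      refine hE _ (fun e he => ⟨K.mkQ e, hφE e he⟩) (Submodule.disjoint_def.2 ?_)
      rintro _ ⟨z, rfl⟩ hz
      obtain ⟨z, rfl⟩ := K.mkQ_surjective z
      have : K.mkQ z = 0 := by simpa using hY hz
      rw [this, map_zero]
    refine codisjoint_iff.2 (eq_top_iff.2 fun x _ => ?_)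
    have hx : φ (K.mkQ x) ∈ E := hr ⟨_, rfl⟩
    have hx' : x - φ (K.mkQ x) ∈ K := hY <| by
      change φ (K.mkQ (x - φ (K.mkQ x))) ∈ K
      rw [map_sub, map_sub, hφE _ hx, sub_self]
      exact K.zero_mem
    exact Submodule.mem_sup.2 ⟨_, hx, _, hx', by simp⟩
  -- By the modular law `(X ⊔ K) ⊓ E = X`, so `X ⊔ K` misses `N`; maximality of `K` then gives `X ≤
  -- K`.
  · have h : Disjoint (X ⊔ K) N := by
      refine disjoint_iff.2 (eq_bot_iff.2 ?_)
      calc (X ⊔ K) ⊓ N ≤ ((X ⊔ K) ⊓ E) ⊓ N := le_inf (inf_le_inf_left _ hNE) inf_le_right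
        _ = X ⊓ N := by rw [sup_inf_assoc_of_le K hXE, inf_comm K E, hEK.eq_bot, sup_bot_eq]
        _ = ⊥ := hXN.eq_bot
    have := hK _ le_sup_right h
    exact disjoint_self.1 (hEK.mono hXE (le_sup_left.trans this))

/-- A direct summand of an injective module is injective. -/
theorem injective_of_isCompl {M : Type u} [AddCommGroup M] [Module R M] [Module.Injective R M]
    {E K : Submodule R M} (h : IsCompl E K) : Module.Injective R E where
  out X Y _ _ _ _ f hf g := by
    obtain ⟨l, hl⟩ := Module.Injective.out f hf (E.subtype ∘ₗ g)
    refine ⟨E.projectionOnto K h ∘ₗ l, fun x => ?_⟩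
    change E.projectionOnto K h (l (f x)) = g x
    rw [hl]
    exact Submodule.projectionOnto_apply_left h (g x)

/-- A nonzero module in which any two nonzero submodules meet is indecomposable. -/
theorem indecomposable_of_uniform (E : ModuleCat.{u} R) (hE : Nontrivial E)
    (h : ∀ A B : Submodule R E, Disjoint A B → A = ⊥ ∨ B = ⊥) : Indecomposable E := by
  refine ⟨fun h => not_subsingleton E (ModuleCat.isZero_iff_subsingleton.1 h), fun Y Z e => ?_⟩
  have hY : Function.Injective (biprod.inl ≫ e.inv : Y ⟶ E).hom :=
    (ModuleCat.mono_iff_injective _).1 inferInstance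
  have hZ : Function.Injective (biprod.inr ≫ e.inv : Z ⟶ E).hom :=
    (ModuleCat.mono_iff_injective _).1 inferInstance
  have key (P : ModuleCat.{u} R) (f : P ⟶ E) (hf : Function.Injective f.hom)
      (h0 : LinearMap.range f.hom = ⊥) : IsZero P := by
    rw [ModuleCat.isZero_iff_subsingleton]
    refine ⟨fun a b => hf ?_⟩
    rw [LinearMap.range_eq_bot] at h0
    simp [h0]
  refine (h (LinearMap.range (biprod.inl ≫ e.inv : Y ⟶ E).hom)
    (LinearMap.range (biprod.inr ≫ e.inv : Z ⟶ E).hom)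
    (Submodule.disjoint_def.2 ?_)).imp (key _ _ hY) (key _ _ hZ)
  rintro _ ⟨y, rfl⟩ ⟨z, hz⟩
  have h1 : (biprod.inl ≫ e.inv : Y ⟶ E) ≫ e.hom ≫ biprod.fst = 𝟙 _ := by simp
  have h2 : (biprod.inr ≫ e.inv : Z ⟶ E) ≫ e.hom ≫ biprod.fst = 0 := by simp
  have h1' := congr($(h1).hom y)
  have h2' := congr($(h2).hom z)
  rw [ModuleCat.hom_comp, LinearMap.comp_apply] at h1' h2'
  rw [hz] at h2'
  have : y = 0 := h1'.symm.trans h2'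
  rw [this, map_zero]

/-- For a prime `p`, the module `R / p` embeds in an indecomposable injective module as an
essential submodule. -/
theorem exists_indecomposable_injective (p : Ideal R) [p.IsPrime] :
    ∃ (E : ModuleCat.{u} R) (f : (R ⧸ p) →ₗ[R] E), Injective E ∧ Indecomposable E ∧
      Function.Injective f := by
  let I : ModuleCat.{u} R := Injective.under (ModuleCat.of R (R ⧸ p))
  let i : (R ⧸ p) →ₗ[R] I := (Injective.ι (ModuleCat.of R (R ⧸ p))).hom
  have hi : Function.Injective i := (ModuleCat.mono_iff_injective _).1 inferInstance
  have : Module.Injective R I := (Module.injective_iff_injective_object R I).2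
    (inferInstanceAs (Injective (Injective.under (ModuleCat.of R (R ⧸ p)))))
  obtain ⟨E, K, hNE, hEK, hess⟩ := exists_essential_isCompl (LinearMap.range i)
  have := injective_of_isCompl hEK
  let f : (R ⧸ p) →ₗ[R] E := i.codRestrict E fun x => hNE ⟨x, rfl⟩
  have hf : Function.Injective f := fun x y h => hi congr(($h).1)
  refine ⟨ModuleCat.of R E, f, (Module.injective_iff_injective_object R E).1 this,
    indecomposable_of_uniform _ hf.nontrivial fun A B hAB => ?_, hf⟩
  -- Essentiality of `R / p` in `E`. Two nonzero submodules then contain the images of some `r, s ∉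
  -- p`, and both contain the nonzero image of `r * s`.
  have meet (X : Submodule R E) (hX : X ≠ ⊥) : ∃ r : R, r ∉ p ∧ f (Ideal.Quotient.mk p r) ∈ X := by
    by_contra! H
    refine hX ((Submodule.map_injective_of_injective E.injective_subtype |>.eq_iff'
      (Submodule.map_bot _)).1 (hess (X.map E.subtype) (Submodule.map_subtype_le _ _) (Submodule.disjoint_def.2 ?_)))
    rintro _ ⟨x, hx, rfl⟩ ⟨y, hy⟩
    obtain ⟨r, rfl⟩ := Ideal.Quotient.mk_surjective y
    have hfx : f (Ideal.Quotient.mk p r) = x := Subtype.ext hy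
    by_cases hr : r ∈ p
    · rw [← hy, Ideal.Quotient.eq_zero_iff_mem.2 hr, map_zero]
    · exact absurd (hfx ▸ hx) (H r hr)
  by_contra! H
  obtain ⟨r, hr, hrA⟩ := meet A H.1
  obtain ⟨s, hs, hsB⟩ := meet B H.2
  have hrs : f (Ideal.Quotient.mk p (r * s)) = 0 := by
    refine Submodule.disjoint_def.1 hAB _ ?_ ?_
    · rw [mul_comm]
      exact (f.map_smul s (Ideal.Quotient.mk p r)) ▸ A.smul_mem s hrA
    · exact (f.map_smul r (Ideal.Quotient.mk p s)) ▸ B.smul_mem r hsB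
  rw [map_eq_zero_iff f hf, Ideal.Quotient.eq_zero_iff_mem] at hrs
  exact (‹p.IsPrime›.mem_or_mem hrs).elim hr hs

end InjectiveModules

/-! ### Split subobjects of indecomposables -/

section SplitMono

variable {C : Type*} [Category* C] [Abelian C]

/-- A split monomorphism into an indecomposable object is an isomorphism or has zero source. -/
theorem isZero_or_isIso_of_indecomposable {A E : C} (m : A ⟶ E) [IsSplitMono m]
    (hE : Indecomposable E) : IsZero A ∨ IsIso m := by
  let s : (ShortComplex.mk m (cokernel.π m) (cokernel.condition m)).Splitting :=
    .ofExactOfRetraction _ (ShortComplex.exact_cokernel m) (retraction m) (IsSplitMono.id m)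
      inferInstance
  refine (hE.2 _ _ s.isoBinaryBiproduct).imp_right fun h => ?_
  have := Preadditive.epi_of_isZero_cokernel m h
  exact isIso_of_mono_of_epi m

end SplitMono

/-! ### Hereditary torsion and torsion ideals -/

section Torsion

variable {R : Type u} [CommRing R] (γ : Abelian.Preradical (ModuleCat.{u} R))

/-- The submodule `γ(M)` of an unbundled module `M`. -/
noncomputable def torsion (M : Type u) [AddCommGroup M] [Module R M] : Submodule R M :=
  valueSubmodule γ (ModuleCat.of R M)

variable {M N : Type u} [AddCommGroup M] [Module R M] [AddCommGroup N] [Module R N]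

theorem injective_ι_app (X : ModuleCat.{u} R) : Function.Injective (γ.ι.app X).hom :=
  (ModuleCat.mono_iff_injective _).1 inferInstance

theorem isZero_r_obj_iff (X : ModuleCat.{u} R) : IsZero (γ.r.obj X) ↔ valueSubmodule γ X = ⊥ := by
  rw [valueSubmodule, LinearMap.range_eq_bot, ModuleCat.isZero_iff_subsingleton]
  refine ⟨fun h => LinearMap.ext fun x => ?_, fun h => ⟨fun a b => injective_ι_app γ X ?_⟩⟩
  · rw [Subsingleton.elim x 0, map_zero, map_zero]
  · rw [h]; rfl

theorem isIso_ι_app_iff (X : ModuleCat.{u} R) : IsIso (γ.ι.app X) ↔ valueSubmodule γ X = ⊤ := by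
  rw [valueSubmodule, LinearMap.range_eq_top, ConcreteCategory.isIso_iff_bijective]
  exact ⟨fun h => h.2, fun h => ⟨injective_ι_app γ X, h⟩⟩

variable {γ}

theorem map_mem_torsion (f : M →ₗ[R] N) {x : M} (hx : x ∈ torsion γ M) : f x ∈ torsion γ N := by
  obtain ⟨y, rfl⟩ := hx
  exact ⟨(γ.r.map (ModuleCat.ofHom f)).hom y,
    congr($(γ.ι.naturality (ModuleCat.ofHom f)).hom y)⟩

/-- Left exact preradicals are hereditary. -/
theorem mem_torsion_of_injective (hγ : PreservesFiniteLimits γ.r) (f : M →ₗ[R] N)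
    (hf : Function.Injective f) {x : M} (hx : f x ∈ torsion γ N) : x ∈ torsion γ M := by
  let S : ShortComplex (ModuleCat.{u} R) := ShortComplex.mk (ModuleCat.ofHom f)
    (ModuleCat.ofHom (LinearMap.range f).mkQ) (by
      ext y
      exact (Submodule.Quotient.mk_eq_zero _).2 ⟨y, rfl⟩)
  have hS : S.ShortExact :=
    { exact := by
        rw [ShortComplex.moduleCat_exact_iff]
        intro y hy
        exact (Submodule.Quotient.mk_eq_zero _).1 hy
      mono_f := (ModuleCat.mono_iff_injective _).2 hf
      epi_g := (ModuleCat.epi_iff_surjective _).2 (Submodule.mkQ_surjective _) }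
  have hE := ((γ.r.preservesFiniteLimits_iff_forall_exact_map_and_mono).1 hγ S hS).1
  rw [ShortComplex.moduleCat_exact_iff] at hE
  obtain ⟨y, hy⟩ := hx
  -- The element `y` of `γ(N)` over `f x` dies in `N / f(M)`, hence in `γ(N / f(M))`; left exactness
  -- lifts it to `γ(M)`.
  obtain ⟨z, hz⟩ := hE y (injective_ι_app γ _ (by
    have h := congr($(γ.ι.naturality S.g).hom y)
    refine (Eq.trans h ?_).trans (map_zero _).symm
    change (LinearMap.range f).mkQ ((γ.ι.app _).hom y) = 0
    rw [hy]
    exact (Submodule.Quotient.mk_eq_zero _).2 ⟨x, rfl⟩))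
  refine ⟨z, hf ?_⟩
  have h := congr($(γ.ι.naturality S.f).hom z)
  rw [← hy, ← hz]
  exact h.symm

variable (γ) in
/-- The ideals `I` such that `R / I` is torsion. -/
def IsTorsionIdeal (I : Ideal R) : Prop :=
  (1 : R ⧸ I) ∈ torsion γ (R ⧸ I)

/-- `R / ann(x)` embeds in `M` with `1 ↦ x`, and `γ` is hereditary. -/
theorem mem_torsion_iff (hγ : PreservesFiniteLimits γ.r) (x : M) :
    x ∈ torsion γ M ↔ IsTorsionIdeal γ (Ideal.torsionOf R M x) := by
  let f : (R ⧸ Ideal.torsionOf R M x) →ₗ[R] M :=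
    (Ideal.torsionOf R M x).liftQ (LinearMap.toSpanSingleton R M x) le_rfl
  have hf : Function.Injective f := by
    rw [← LinearMap.ker_eq_bot]
    exact Submodule.ker_liftQ_eq_bot _ _ _ le_rfl
  have h1 : f 1 = x := one_smul R x
  refine ⟨fun h => mem_torsion_of_injective hγ f hf (by rwa [h1]), fun h => ?_⟩
  have h' := map_mem_torsion f h
  rwa [h1] at h'

theorem IsTorsionIdeal.mono {I J : Ideal R} (hI : IsTorsionIdeal γ I) (h : I ≤ J) :
    IsTorsionIdeal γ J :=
  map_mem_torsion (Submodule.factor h) hI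

/-- `R / (I ⊓ J)` embeds in `R / I × R / J`. -/
theorem IsTorsionIdeal.inf (hγ : PreservesFiniteLimits γ.r) {I J : Ideal R}
    (hI : IsTorsionIdeal γ I) (hJ : IsTorsionIdeal γ J) : IsTorsionIdeal γ (I ⊓ J) := by
  let f : (R ⧸ I ⊓ J) →ₗ[R] (R ⧸ I) × (R ⧸ J) :=
    (Submodule.factor inf_le_left).prod (Submodule.factor inf_le_right)
  refine mem_torsion_of_injective hγ f ((injective_iff_map_eq_zero _).2 fun x hx => ?_) ?_
  · obtain ⟨x, rfl⟩ := Ideal.Quotient.mk_surjective x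
    exact Ideal.Quotient.eq_zero_iff_mem.2 ⟨Ideal.Quotient.eq_zero_iff_mem.1 congr(($hx).1),
      Ideal.Quotient.eq_zero_iff_mem.1 congr(($hx).2)⟩
  · have : f 1 = LinearMap.inl R (R ⧸ I) (R ⧸ J) 1 + LinearMap.inr R (R ⧸ I) (R ⧸ J) 1 :=
      Prod.ext (add_zero _).symm (zero_add _).symm
    rw [this]
    exact add_mem (map_mem_torsion _ hI) (map_mem_torsion _ hJ)

theorem isTorsionIdeal_top : IsTorsionIdeal γ (⊤ : Ideal R) := by
  have := Ideal.Quotient.subsingleton_iff.2 (rfl : (⊤ : Ideal R) = ⊤)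
  rw [IsTorsionIdeal, Subsingleton.elim (1 : R ⧸ (⊤ : Ideal R)) 0]
  exact zero_mem _

end Torsion

/-! ### Section functors as families of submodules -/

section SectionFunctor

variable {R : Type u} [CommRing R] {γ : Abelian.Preradical (ModuleCat.{u} R)}

theorem mem_sectionSubmodule_iff {M : Type*} [AddCommGroup M] [Module R M]
    (W : Set (PrimeSpectrum R)) (x : M) :
    x ∈ sectionSubmodule W M ↔
      ∀ p : PrimeSpectrum R, Ideal.torsionOf R M x ≤ p.asIdeal → p ∈ W :=
  support_span_singleton_subset_iff W x

/-- A subfunctor of the identity is determined, up to isomorphism over the identity, by its values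
as submodules; naturality is automatic because the inclusions are monic. -/
theorem isSectionFunctor_iff :
    IsSectionFunctor γ ↔ ∃ W : Set (PrimeSpectrum R), StableUnderSpecialization W ∧
      ∀ (M : Type u) [AddCommGroup M] [Module R M], torsion γ M = sectionSubmodule W M := by
  refine exists_congr fun W => and_congr_right fun _ => ⟨fun ⟨e⟩ M _ _ => le_antisymm ?_ ?_,
    fun h => ⟨?_⟩⟩
  · rintro _ ⟨y, rfl⟩
    have h : e.hom.hom.left.app (ModuleCat.of R M) ≫ (sectionInclusion W).app _ =
      γ.ι.app (ModuleCat.of R M) := congr($(Over.w e.hom.hom).app (ModuleCat.of R M))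
    rw [← h]
    exact ((e.hom.hom.left.app (ModuleCat.of R M)).hom y).2
  · intro x hx
    have h : e.inv.hom.left.app (ModuleCat.of R M) ≫ γ.ι.app _ =
      (sectionInclusion W).app (ModuleCat.of R M) :=
        congr($(Over.w e.inv.hom).app (ModuleCat.of R M))
    exact ⟨(e.inv.hom.left.app (ModuleCat.of R M)).hom ⟨x, hx⟩, congr($(h).hom ⟨x, hx⟩)⟩
  · let e (X : ModuleCat.{u} R) : γ.r.obj X ≅ (sectionFunctor W).obj X :=
      ((LinearEquiv.ofInjective (γ.ι.app X).hom (injective_ι_app γ X)).trans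
        (LinearEquiv.ofEq _ _ (h X))).toModuleIso
    have he (X : ModuleCat.{u} R) :
        (e X).hom ≫ (sectionInclusion W).app X = γ.ι.app X := rfl
    have nat {X Y : ModuleCat.{u} R} (f : X ⟶ Y) :
        γ.r.map f ≫ (e Y).hom = (e X).hom ≫ (sectionFunctor W).map f := by
      rw [← cancel_mono ((sectionInclusion W).app Y), Category.assoc, Category.assoc, he,
        (sectionInclusion W).naturality, reassoc_of% he]
      exact γ.ι.naturality f
    exact MonoOver.isoMk (NatIso.ofComponents e nat) (by ext X : 2; exact he X)

end SectionFunctor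

/-! ### The implications between the four conditions -/

section Algebra

variable {R : Type u} [CommRing R] {γ : Abelian.Preradical (ModuleCat.{u} R)}

theorem isRadicalFunctor_iff :
    IsRadicalFunctor γ ↔
      ∀ (M : Type u) [AddCommGroup M] [Module R M], torsion γ (M ⧸ torsion γ M) = ⊥ :=
  ⟨fun h M _ _ => (isZero_r_obj_iff γ _).1 (h (ModuleCat.of R M)),
    fun h M => (isZero_r_obj_iff γ _).2 (h M)⟩

theorem exists_prime_torsionOf_eq [IsNoetherianRing R] {M : Type*} [AddCommGroup M] [Module R M]
    [Nontrivial M] :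
    ∃ (p : PrimeSpectrum R) (x : M), Ideal.torsionOf R M x = p.asIdeal := by
  obtain ⟨p, hp⟩ := associatedPrimes.nonempty R M
  obtain ⟨hp, x, hx⟩ := isAssociatedPrime_iff.1 hp
  refine ⟨⟨p, hp⟩, x, ?_⟩
  ext r
  simp [hx, Submodule.mem_colon_singleton]

/-- `W` is the set of torsion primes. Upward closure of torsion ideals gives both its stability and
`γ ⊆ Γ_W`; the hypothesis is the reverse inclusion. -/
theorem isSectionFunctor_of_forall_isTorsionIdeal (hγ : PreservesFiniteLimits γ.r)
    (h : ∀ I : Ideal R, (∀ p : PrimeSpectrum R, I ≤ p.asIdeal → IsTorsionIdeal γ p.asIdeal) →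
      IsTorsionIdeal γ I) : IsSectionFunctor γ := by
  refine isSectionFunctor_iff.2 ⟨{p | IsTorsionIdeal γ p.asIdeal}, fun p q hpq hp => ?_,
    fun M _ _ => ?_⟩
  · exact IsTorsionIdeal.mono hp ((PrimeSpectrum.le_iff_specializes p q).2 hpq)
  · ext x
    rw [mem_torsion_iff hγ, mem_sectionSubmodule_iff]
    exact ⟨fun hx p hp => hx.mono hp, h _⟩

variable [IsNoetherianRing R]

theorem IsRadicalFunctor.isSectionFunctor (hγ : PreservesFiniteLimits γ.r)
    (h : IsRadicalFunctor γ) : IsSectionFunctor γ := by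
  rw [isRadicalFunctor_iff] at h
  refine isSectionFunctor_of_forall_isTorsionIdeal hγ fun I hI => ?_
  let Q := (R ⧸ I) ⧸ torsion γ (R ⧸ I)
  rcases subsingleton_or_nontrivial Q with hQ | hQ
  · exact (eq_top_iff.1 (Submodule.Quotient.subsingleton_iff.1 hQ)) Submodule.mem_top
  -- An associated prime of `Q` contains `I`, so it is torsion and `x` is a nonzero torsion element
  -- of `Q`, against radicality.
  · obtain ⟨p, x, hx⟩ := exists_prime_torsionOf_eq (R := R) (M := Q)
    have hIp : I ≤ p.asIdeal := fun r hr => by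
      rw [← hx, Ideal.mem_torsionOf_iff]
      obtain ⟨y, rfl⟩ := Submodule.mkQ_surjective _ x
      obtain ⟨y, rfl⟩ := Ideal.Quotient.mk_surjective y
      rw [← map_smul]
      have : r • Ideal.Quotient.mk I y = 0 :=
        Ideal.Quotient.eq_zero_iff_mem.2 (I.mul_mem_right y hr)
      rw [this, map_zero]
    have hxt : x ∈ torsion γ Q := (mem_torsion_iff hγ x).2 (hx ▸ hI p hIp)
    rw [h, Submodule.mem_bot] at hxt
    exact absurd (hx.symm.trans ((Ideal.torsionOf_eq_top_iff R x).2 hxt)) p.2.ne_top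

omit [IsNoetherianRing R] in
theorem exists_notMem_smul_eq_zero {M : Type*} [AddCommGroup M] [Module R M]
    {W : Set (PrimeSpectrum R)} {p : PrimeSpectrum R} (hp : p ∉ W) {x : M}
    (hx : x ∈ sectionSubmodule W M) : ∃ t ∉ p.asIdeal, t • x = 0 := by
  by_contra! H
  exact hp ((mem_sectionSubmodule_iff W x).1 hx p fun t ht => by_contra fun h => H t h ht)

omit [IsNoetherianRing R] in
-- For `p ∉ W`, some `t ∉ p` moves `x` into `Γ_W(M)` and some `s ∉ p` kills `t • x`; then `s * t ∉
-- p` kills `x`.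
theorem mem_sectionSubmodule_of_mkQ_mem {M : Type*} [AddCommGroup M] [Module R M]
    {W : Set (PrimeSpectrum R)} {x : M}
    (hx : (sectionSubmodule W M).mkQ x ∈ sectionSubmodule W (M ⧸ sectionSubmodule W M)) :
    x ∈ sectionSubmodule W M := by
  rw [mem_sectionSubmodule_iff]
  intro p hp
  by_contra hpW
  obtain ⟨t, htp, ht⟩ := exists_notMem_smul_eq_zero hpW hx
  rw [← map_smul, Submodule.mkQ_apply, Submodule.Quotient.mk_eq_zero] at ht
  obtain ⟨s, hsp, hs⟩ := exists_notMem_smul_eq_zero hpW ht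
  refine (p.2.mem_or_mem (hp (?_ : s * t ∈ Ideal.torsionOf R M x))).elim hsp htp
  rwa [Ideal.mem_torsionOf_iff, mul_smul]

omit [IsNoetherianRing R] in
theorem IsSectionFunctor.isRadicalFunctor (h : IsSectionFunctor γ) : IsRadicalFunctor γ := by
  obtain ⟨W, -, hW⟩ := isSectionFunctor_iff.1 h
  refine isRadicalFunctor_iff.2 fun M _ _ => ?_
  rw [hW M, hW]
  refine eq_bot_iff.2 fun x hx => ?_
  obtain ⟨x, rfl⟩ := Submodule.mkQ_surjective _ x
  exact (Submodule.Quotient.mk_eq_zero _).2 (mem_sectionSubmodule_of_mkQ_mem hx)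

/-- Over a noetherian ring, essential extensions of modules supported in `W` are supported
in `W`. -/
theorem le_sectionSubmodule_of_essential {M : Type*} [AddCommGroup M] [Module R M]
    {W : Set (PrimeSpectrum R)} (hW : StableUnderSpecialization W) {E : Submodule R M}
    (hE : ∀ X ≤ E, Disjoint X (sectionSubmodule W M) → X = ⊥) : E ≤ sectionSubmodule W M := by
  by_contra hEW
  set S := sectionSubmodule W M
  have : Nontrivial (E.map S.mkQ) := by
    rw [Submodule.nontrivial_iff_ne_bot]
    intro h
    refine hEW fun x hx => (Submodule.Quotient.mk_eq_zero S).1 ?_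
    exact (Submodule.mem_bot R).1 (h ▸ Submodule.mem_map_of_mem hx)
  -- An associated prime `p` of the image of `E` in `M / S`. It lies outside `W`, since otherwise
  -- the class of `x` would lie in `Γ_W(M / S) = 0`.
  obtain ⟨p, ⟨_, x, hxE, rfl⟩, hp⟩ := exists_prime_torsionOf_eq (R := R) (M := E.map S.mkQ)
  have hp' (r : R) : r ∈ p.asIdeal ↔ r • x ∈ S := by
    rw [← hp, Ideal.mem_torsionOf_iff, ← Submodule.Quotient.mk_eq_zero S, Subtype.ext_iff]
    rfl
  have hxS : x ∉ S := fun h =>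
    p.2.ne_top ((Ideal.eq_top_iff_one _).2 ((hp' 1).2 (by rwa [one_smul])))
  have hpW : p ∉ W := fun hpW => by
    refine hxS (mem_sectionSubmodule_of_mkQ_mem ((mem_sectionSubmodule_iff W _).2 fun q hq => ?_))
    refine hW ((PrimeSpectrum.le_iff_specializes p q).1 fun r hr => hq ?_) hpW
    rw [Ideal.mem_torsionOf_iff, ← map_smul]
    exact (Submodule.Quotient.mk_eq_zero S).2 ((hp' r).1 hr)
  -- With `ann(s • x)` maximal for `s ∉ p`, a multiple of `s • x` in `S` is killed by some `t ∉ p`,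
  -- hence already zero. So the span of `s • x` misses `S`, and essentiality gives `s • x = 0`,
  -- contradicting `s ∉ p`.
  obtain ⟨J, ⟨s, hs, rfl⟩, hmax⟩ := set_has_maximal_iff_noetherian.2 ‹IsNoetherianRing R›
    {J : Ideal R | ∃ s ∉ p.asIdeal, J = Ideal.torsionOf R M (s • x)}
    ⟨_, 1, fun h => p.2.ne_top ((Ideal.eq_top_iff_one _).2 h), rfl⟩
  refine hs ((hp' s).2 ?_)
  have hJ (r : R) (hr : r • s • x ∈ S) : r • s • x = 0 := by
    obtain ⟨t, htp, ht⟩ := exists_notMem_smul_eq_zero hpW hr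
    by_contra hrs
    refine hmax _ ⟨t * s, fun h => (p.2.mem_or_mem h).elim htp hs, rfl⟩
      (lt_of_le_of_ne (fun a ha => ?_) fun h => hrs ?_)
    · rw [Ideal.mem_torsionOf_iff] at ha ⊢
      rw [mul_smul, smul_comm, ha, smul_zero]
    · rw [← Ideal.mem_torsionOf_iff, h, Ideal.mem_torsionOf_iff, mul_smul, smul_comm, ht]
  have hbot := hE (Submodule.span R {s • x})
    (Submodule.span_le.2 (by simpa using E.smul_mem s hxE)) (Submodule.disjoint_def.2 ?_)
  · rw [Submodule.span_singleton_eq_bot.1 hbot]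
    exact S.zero_mem
  · rintro y hy hyS
    obtain ⟨r, rfl⟩ := Submodule.mem_span_singleton.1 hy
    exact hJ r hyS

/-- `Γ_W(I)` is essential in a direct summand `E` of `I`, and essential extensions stay inside
`Γ_W`, so `Γ_W(I) = E`. -/
theorem IsSectionFunctor.preservesInjectiveObjects (h : IsSectionFunctor γ) :
    γ.r.PreservesInjectiveObjects where
  injective_obj {I} hI := by
    obtain ⟨W, hs, hW⟩ := isSectionFunctor_iff.1 h
    have : Module.Injective R I := (Module.injective_iff_injective_object R I).2 hI
    obtain ⟨E, K, hSE, hEK, hess⟩ := exists_essential_isCompl (sectionSubmodule W I)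
    have hE : E = valueSubmodule γ I :=
      ((le_sectionSubmodule_of_essential hs hess).antisymm hSE).trans (hW I).symm
    have := injective_of_isCompl hEK
    have : Injective (ModuleCat.of R E) := (Module.injective_iff_injective_object R E).1 this
    exact Injective.of_iso (((LinearEquiv.ofInjective (γ.ι.app I).hom (injective_ι_app γ I)).trans
        (LinearEquiv.ofEq _ _ hE.symm)).toModuleIso.symm) this

omit [IsNoetherianRing R] in
theorem isRadicalFunctor_of_preservesInjectiveObjects (hγ : PreservesFiniteLimits γ.r)
    (h : γ.r.PreservesInjectiveObjects) : IsRadicalFunctor γ := by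
  refine isRadicalFunctor_iff.2 fun M _ _ => eq_bot_iff.2 fun x hx => ?_
  obtain ⟨x, rfl⟩ := Submodule.mkQ_surjective _ x
  let I : ModuleCat.{u} R := Injective.under (ModuleCat.of R M)
  let f : M →ₗ[R] I := (Injective.ι (ModuleCat.of R M)).hom
  have hf : Function.Injective f := (ModuleCat.mono_iff_injective _).1 inferInstance
  have hI : Injective I := inferInstanceAs (Injective (Injective.under (ModuleCat.of R M)))
  have hγI : Injective (γ.r.obj I) := inferInstance
  let r : I ⟶ γ.r.obj I := Injective.factorThru (𝟙 _) (γ.ι.app I)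
  have hr : γ.ι.app I ≫ r = 𝟙 _ := Injective.comp_factorThru _ _
  let j : γ.r.obj I →ₗ[R] I := (γ.ι.app I).hom
  -- Subtracting the component in `γ(I)` makes `g` vanish on `γ(M)`, so `g` factors through `M /
  -- γ(M)` and sends `x` into `γ(I)`. Then `f x ∈ γ(I)`, and heredity applies.
  let g : M →ₗ[R] I := f - j ∘ₗ r.hom ∘ₗ f
  have hg : torsion γ M ≤ LinearMap.ker g := fun m hm => by
    obtain ⟨z, hz⟩ := map_mem_torsion f hm
    have h : f m = j z := hz.symm
    change f m - j (r.hom (f m)) = 0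
    rw [h, show r.hom (j z) = z from congr($(hr).hom z), sub_self]
  have hx' : g x ∈ torsion γ I := map_mem_torsion ((torsion γ M).liftQ g hg) hx
  refine (Submodule.Quotient.mk_eq_zero _).2 (mem_torsion_of_injective hγ f hf ?_)
  have : f x = g x + j (r.hom (f x)) := (sub_add_cancel _ _).symm
  rw [this]
  exact add_mem hx' ⟨_, rfl⟩

/-- A left exact preradical functor which is zero or the identity on each indecomposable injective
module is a section functor. -/
theorem isSectionFunctor_of_indecomposable (hγ : PreservesFiniteLimits γ.r)
    (h : ∀ E : ModuleCat.{u} R, Injective E → Indecomposable E →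
      IsIso (γ.ι.app E) ∨ IsZero (γ.r.obj E)) : IsSectionFunctor γ := by
  refine isSectionFunctor_of_forall_isTorsionIdeal hγ fun I => ?_
  induction I using IsNoetherian.induction with
  | hgt I ih =>
  intro hI
  by_cases hirr : InfIrred I
  swap
  · rw [InfIrred, not_and_or] at hirr
    rcases hirr with hI' | hI'
    · rw [not_not, isMax_iff_eq_top] at hI'
      exact hI' ▸ isTorsionIdeal_top
    · push Not at hI'
      obtain ⟨A, B, hAB, hA, hB⟩ := hI'
      rw [← hAB]
      have hA' : I < A := lt_of_le_of_ne (hAB ▸ inf_le_left) hA.symm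
      have hB' : I < B := lt_of_le_of_ne (hAB ▸ inf_le_right) hB.symm
      exact (ih A hA' fun p hp => hI p (hA'.le.trans hp)).inf hγ
        (ih B hB' fun p hp => hI p (hB'.le.trans hp))
  have : Nontrivial (R ⧸ I) := Ideal.Quotient.nontrivial_iff.2 fun h => hirr.1 (h ▸ isMax_top)
  obtain ⟨p, y, hp⟩ := exists_prime_torsionOf_eq (R := R) (M := R ⧸ I)
  obtain ⟨y, rfl⟩ := Ideal.Quotient.mk_surjective y
  have hp' (r : R) : r ∈ p.asIdeal ↔ r * y ∈ I := by
    rw [← hp, Ideal.mem_torsionOf_iff, ← Ideal.Quotient.eq_zero_iff_mem]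
    rfl
  have hIp : I ≤ p.asIdeal := fun r hr => (hp' r).2 (Ideal.mul_mem_right y I hr)
  obtain ⟨E, i, hE, hEi, hi⟩ := exists_indecomposable_injective p.asIdeal
  have hi1 : i 1 ∈ torsion γ E := map_mem_torsion i (hI p hIp)
  have htop : torsion γ E = ⊤ := by
    refine (isIso_ι_app_iff γ E).1 ((h E hE hEi).resolve_right fun h0 => ?_)
    have hbot : torsion γ E = ⊥ := (isZero_r_obj_iff γ E).1 h0
    rw [hbot, Submodule.mem_bot, map_eq_zero_iff i hi] at hi1
    exact one_ne_zero hi1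
  let f : (R ⧸ p.asIdeal) →ₗ[R] (R ⧸ I) :=
    p.asIdeal.liftQ (LinearMap.toSpanSingleton R (R ⧸ I) (Ideal.Quotient.mk I y)) hp.ge
  have hf : Function.Injective f := by
    rw [← LinearMap.ker_eq_bot]
    exact Submodule.ker_liftQ_eq_bot _ _ _ hp.le
  have : Module.Injective R E := (Module.injective_iff_injective_object R E).2 hE
  -- The embedding of `R / p ≅ R y ⊆ R / I` in `E` extends to `g` on `R / I`.
  obtain ⟨g, hg⟩ := Module.Injective.out f hf i
  have hg' (r : R) (hr : g (Ideal.Quotient.mk I (r * y)) = 0) : r * y ∈ I := by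
    have h1 : f (Ideal.Quotient.mk _ r) = Ideal.Quotient.mk I (r * y) := rfl
    rw [← h1, hg, map_eq_zero_iff i hi, Ideal.Quotient.eq_zero_iff_mem] at hr
    exact (hp' r).1 hr
  let A : Ideal R := LinearMap.ker (g ∘ₗ I.mkQ)
  have hA (r : R) : r ∈ A ↔ g (Ideal.Quotient.mk I r) = 0 := Iff.rfl
  have hIA : I ≤ A := fun r hr => by
    rw [hA, Ideal.Quotient.eq_zero_iff_mem.2 hr, map_zero]
  -- Since `g` is injective on the span of `y` modulo `I`, this holds. As `y ∉ I`, irreducibility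
  -- forces `A = I`, so `g` is injective.
  have hinf : A ⊓ (I ⊔ Ideal.span {y}) = I := by
    refine le_antisymm ?_ (le_inf hIA le_sup_left)
    rintro a ⟨haA, haB⟩
    obtain ⟨b, hb, c, hc, rfl⟩ := Submodule.mem_sup.1 haB
    obtain ⟨r, rfl⟩ := Ideal.mem_span_singleton'.1 hc
    have hrA : r * y ∈ A := (A.add_mem_iff_right (hIA hb)).1 haA
    exact I.add_mem hb (hg' r ((hA _).1 hrA))
  have hAI : A = I := (hirr.2 hinf).resolve_right fun h => p.2.ne_top <| by
    rw [Ideal.eq_top_iff_one, hp', one_mul, ← h]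
    exact Ideal.mem_sup_right (Ideal.mem_span_singleton_self y)
  have hginj : Function.Injective g := (injective_iff_map_eq_zero _).2 fun x hx => by
    obtain ⟨x, rfl⟩ := Ideal.Quotient.mk_surjective x
    exact Ideal.Quotient.eq_zero_iff_mem.2 (hAI ▸ (hA x).2 hx)
  exact mem_torsion_of_injective hγ g hginj (htop ▸ Submodule.mem_top)

omit [IsNoetherianRing R] in
theorem isAbstractLocalCohomology_of_preservesInjectiveObjects
    [HasDerivedCategory.{w} (ModuleCat.{u} R)] (h : γ.r.PreservesInjectiveObjects)
    (h₁ : ∀ X, IsIso (γ.ι.app (γ.r.obj X))) :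
    IsAbstractLocalCohomology γ.r.rightDerivedFunctorPlus where
  triangle := exists_commShift_isTriangulated γ.r
  adjoint := rightDerivedFunctorPlus_exists_rightAdjoint γ.r γ.ι h₁ fun X => by
    rw [Abelian.Preradical.r_map_ι_app]
    exact h₁ X
  divides E _ hE := by
    have hs : IsSplitMono (γ.ι.app E) :=
      ⟨⟨⟨Injective.factorThru (𝟙 _) (γ.ι.app E), Injective.comp_factorThru _ _⟩⟩⟩
    rw [kernel_rightDerivedFunctorPlus_single_iff]
    refine (isZero_or_isIso_of_indecomposable (γ.ι.app E) hE).symm.imp_left fun hι => ?_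
    obtain ⟨e⟩ := nonempty_rightDerivedFunctorPlus_obj_single_iso γ.r E
    exact ⟨_, ⟨e ≪≫ (DerivedCategory.Plus.singleFunctor _ 0).mapIso (@asIso _ _ _ _ _ hι)⟩⟩

omit [IsNoetherianRing R] in
-- Heredity along `γ(X) ⊆ X` makes `γ` idempotent.
theorem isIso_ι_app_r_obj (hγ : PreservesFiniteLimits γ.r) (X : ModuleCat.{u} R) :
    IsIso (γ.ι.app (γ.r.obj X)) :=
  (isIso_ι_app_iff γ _).2 <| eq_top_iff.2 fun x _ =>
    mem_torsion_of_injective hγ (γ.ι.app X).hom (injective_ι_app γ X) ⟨x, rfl⟩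

omit [IsNoetherianRing R] in
theorem IsAbstractLocalCohomology.isIso_or_isZero
    [HasDerivedCategory.{w} (ModuleCat.{u} R)] (hγ : PreservesFiniteLimits γ.r)
    (h : IsAbstractLocalCohomology γ.r.rightDerivedFunctorPlus) (E : ModuleCat.{u} R)
    (hE : Injective E) (hE' : Indecomposable E) :
    IsIso (γ.ι.app E) ∨ IsZero (γ.r.obj E) := by
  refine (h.divides E hE hE').imp (fun hX => ?_)
    (kernel_rightDerivedFunctorPlus_single_iff γ.r E).1
  obtain ⟨ρ, ⟨adj⟩, ⟨e⟩⟩ := h.adjoint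
  obtain ⟨e₁⟩ := nonempty_iso_obj_of_essImage adj e hX
  obtain ⟨e₂⟩ := nonempty_rightDerivedFunctorPlus_obj_single_iso γ.r E
  obtain ⟨e₃⟩ := nonempty_iso_of_singleFunctor_obj_iso (e₂.symm ≪≫ e₁)
  -- The isomorphism `γ(E) ≅ E` is only abstract; idempotence and naturality transfer invertibility
  -- to the inclusion itself.
  exact (NatTrans.isIso_app_iff_of_iso γ.ι e₃).1 (isIso_ι_app_r_obj hγ E)

end Algebra

end LocalCohomologyFunctors

theorem theorem2p6 {R : Type u} [CommRing R] [IsNoetherianRing R]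
    [HasDerivedCategory.{w} (ModuleCat.{u} R)]
    (γ : Abelian.Preradical (ModuleCat.{u} R)) (hγ : PreservesFiniteLimits γ.r) :
    List.TFAE
      [LocalCohomologyFunctors.IsRadicalFunctor γ,
       γ.r.PreservesInjectiveObjects,
       LocalCohomologyFunctors.IsSectionFunctor γ,
       LocalCohomologyFunctors.IsAbstractLocalCohomology γ.r.rightDerivedFunctorPlus] := by
  tfae_have 1 → 3 := fun h => h.isSectionFunctor hγ
  tfae_have 3 → 2 := fun h => h.preservesInjectiveObjects
  tfae_have 2 → 1 :=
    LocalCohomologyFunctors.isRadicalFunctor_of_preservesInjectiveObjects hγ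
  tfae_have 2 → 4 := fun h =>
    LocalCohomologyFunctors.isAbstractLocalCohomology_of_preservesInjectiveObjects h
      (LocalCohomologyFunctors.isIso_ι_app_r_obj hγ)
  tfae_have 4 → 3 := fun h =>
    LocalCohomologyFunctors.isSectionFunctor_of_indecomposable hγ fun E hE hE' =>
      h.isIso_or_isZero hγ E hE hE'
  tfae_finish
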